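/- Let $A=[\mathbf a_1,\mathbf a_2,\mathbf a_3]$ and $A'=[\mathbf a_1',\mathbf a_2',\mathbf a_3']$ be real $4\times 3$ matrices with columns $\mathbf a_i,\mathbf a_i'\in\mathbb R^4$, and suppose that $\mathbf a_3$ and $\mathbf a_3'$ are linearly independent. For $\mathbf v\in\mathbb R^4\setminus\{0\}$ let $\left[A\;\tfrac{\mathbf v}{\|\mathbf v\|}\right]$ be the $4\times4$ matrix obtained by appending the column $\mathbf v/\|\mathbf v\|$ to $A$, and let $\mathrm{proj}_{\mathbf v^\perp}$ denote the orthogonal projection of $\mathbb R^4$ onto the orthogonal complement of $\mathbf v$. Then the integral $$I_{\langle \mathrm{Lk}^2\rangle}(A,A')=\frac{1}{(2\pi)^2}\int_{\mathbb R^4}\frac{\det\left[A\;\tfrac{\mathbf v}{\|\mathbf v\|}\right]\det\left[A'\;\tfrac{\mathbf v}{\|\mathbf v\|}\right]}{\|\mathrm{proj}_{\mathbf v^\perp}(\mathbf a_3)\|^3\,\|\mathrm{proj}_{\mathbf v^\perp}(\mathbf a_3')\|^3}\,e^{-\|\mathbf v\|^2/2}\,d\mathbf v$$ converges absolutely, and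 $$\frac{\pi}{2}\,I_{\langle \mathrm{Lk}^2\rangle}(A,A')=\frac{\left(\|\mathbf a_3\|^2\|\mathbf a_3'\|^2-(\mathbf a_3\cdot\mathbf a_3')^2\right)\det(A^TA')+(\mathbf a_3\cdot\mathbf a_3')\,\det[\mathbf a_3,\mathbf a_1',\mathbf a_2',\mathbf a_3']\,\det[\mathbf a_3',\mathbf a_1,\mathbf a_2,\mathbf a_3]}{\|\mathbf a_3\|^2\|\mathbf a_3'\|^2\left(\|\mathbf a_3\|^2\|\mathbf a_3'\|^2-(\mathbf a_3\cdot\mathbf a_3')^2\right)^{3/2}} .$$ -/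

import Mathlib

open scoped Matrix

noncomputable section

/-- The `j`-th column of a `4 × 3` matrix, as a vector of Euclidean space `ℝ⁴`
(so columns `0`, `1`, `2` are `a₁`, `a₂`, `a₃`). -/
def colVec (A : Matrix (Fin 4) (Fin 3) ℝ) (j : Fin 3) : EuclideanSpace ℝ (Fin 4) :=
  WithLp.toLp 2 (A.col j)

/-- The square matrix `[A  x]`: the column `x` is appended on the right of `A`. -/
def appendCol (A : Matrix (Fin 4) (Fin 3) ℝ) (x : EuclideanSpace ℝ (Fin 4)) :
    Matrix (Fin 4) (Fin 4) ℝ :=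
  Matrix.of fun i => Fin.snoc (α := fun _ => ℝ) (A i) (x i)

/-- The square matrix `[x  A]`: the column `x` is put on the left of `A`. -/
def prependCol (x : EuclideanSpace ℝ (Fin 4)) (A : Matrix (Fin 4) (Fin 3) ℝ) :
    Matrix (Fin 4) (Fin 4) ℝ :=
  Matrix.of fun i => Fin.cons (α := fun _ => ℝ) (x i) (A i)

/-- The norm of the orthogonal projection of `x` to the orthogonal complement of the line
spanned by `v`. -/
def normProjPerp (v x : EuclideanSpace ℝ (Fin 4)) : ℝ :=
  ‖(Submodule.span ℝ {v})ᗮ.starProjection x‖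

/-- The integrand (with the Gaussian weight) of the integral over `ℝ⁴`. -/
def linkIntegrand (A A' : Matrix (Fin 4) (Fin 3) ℝ) (v : EuclideanSpace ℝ (Fin 4)) : ℝ :=
  (appendCol A (‖v‖⁻¹ • v)).det * (appendCol A' (‖v‖⁻¹ • v)).det /
      (normProjPerp v (colVec A 2) ^ 3 * normProjPerp v (colVec A' 2) ^ 3) *
    Real.exp (-‖v‖ ^ 2 / 2)

/-- The function `I_{⟨Lk²⟩}(A, A')`. -/
def ILinkSq (A A' : Matrix (Fin 4) (Fin 3) ℝ) : ℝ :=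
  1 / (2 * Real.pi) ^ 2 * ∫ v : EuclideanSpace ℝ (Fin 4), linkIntegrand A A' v

end

/-! Write c, d for the third columns and n, n' for the generalized cross products, so that n ⊥ c and
n' ⊥ d. The determinants are the linear forms ⟨n, v⟩, ⟨n', v⟩ over ‖v‖, and the projections are
roots of Gram determinants over ‖v‖.

Use an orthonormal basis with c on the first axis and d in the plane of the first two. Let β and α
be the components of v in that plane orthogonal to c and to d, and y the other two coordinates. The
Gram determinants are ‖c‖²(β² + |y|²) and ‖d‖²(α² + |y|²). Substituting (α, β) = |y| p gives ‖v‖ =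
κ(p)|y|; then replacing y by y/κ(p) frees the Gaussian of p, and by homogeneity in dimension 4 all
powers of κ cancel (`planarIntegrand_scaled`).

In the resulting product of a weight in p and a Gaussian in y, odd terms vanish and only the
y-components of n and n' survive (`separatedIntegrand_integrable_and_integral`). Integrability is
pulled back through the substitutions, and orthogonality makes the answer basis-free. -/

/-! ### Determinants as linear forms, projections as Gram determinants -/

theorem appendCol_eq (A : Matrix (Fin 4) (Fin 3) ℝ) (x : EuclideanSpace ℝ (Fin 4)) :
    appendCol A x = !![A 0 0, A 0 1, A 0 2, x 0; A 1 0, A 1 1, A 1 2, x 1;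
      A 2 0, A 2 1, A 2 2, x 2; A 3 0, A 3 1, A 3 2, x 3] := by
  ext i j; fin_cases i <;> fin_cases j <;> rfl

theorem prependCol_eq (A : Matrix (Fin 4) (Fin 3) ℝ) (x : EuclideanSpace ℝ (Fin 4)) :
    prependCol x A = !![x 0, A 0 0, A 0 1, A 0 2; x 1, A 1 0, A 1 1, A 1 2;
      x 2, A 2 0, A 2 1, A 2 2; x 3, A 3 0, A 3 1, A 3 2] := by
  ext i j; fin_cases i <;> fin_cases j <;> rfl

/-- The minor of `A` formed by the rows `i`, `j`, `k`. -/
def rowMinor (A : Matrix (Fin 4) (Fin 3) ℝ) (i j k : Fin 4) : ℝ :=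
  A i 0 * (A j 1 * A k 2 - A j 2 * A k 1) - A i 1 * (A j 0 * A k 2 - A j 2 * A k 0) +
    A i 2 * (A j 0 * A k 1 - A j 1 * A k 0)

/-- The generalized cross product of the columns of `A`. -/
noncomputable def crossVec (A : Matrix (Fin 4) (Fin 3) ℝ) : EuclideanSpace ℝ (Fin 4) :=
  !₂[-rowMinor A 1 2 3, rowMinor A 0 2 3, -rowMinor A 0 1 3, rowMinor A 0 1 2]

theorem inner_crossVec (A : Matrix (Fin 4) (Fin 3) ℝ) (x : EuclideanSpace ℝ (Fin 4)) :
    inner ℝ (crossVec A) x = -rowMinor A 1 2 3 * x 0 + rowMinor A 0 2 3 * x 1 -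
      rowMinor A 0 1 3 * x 2 + rowMinor A 0 1 2 * x 3 := by
  simp [crossVec, PiLp.inner_apply, Fin.sum_univ_four]
  ring

theorem det_appendCol (A : Matrix (Fin 4) (Fin 3) ℝ) (x : EuclideanSpace ℝ (Fin 4)) :
    (appendCol A x).det = inner ℝ (crossVec A) x := by
  rw [appendCol_eq, inner_crossVec]
  simp [Matrix.det_succ_row_zero, Fin.sum_univ_succ, Fin.succAbove, rowMinor]
  ring

theorem det_prependCol (A : Matrix (Fin 4) (Fin 3) ℝ) (x : EuclideanSpace ℝ (Fin 4)) :
    (prependCol x A).det = - inner ℝ (crossVec A) x := by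
  rw [prependCol_eq, inner_crossVec]
  simp [Matrix.det_succ_row_zero, Fin.sum_univ_succ, Fin.succAbove, rowMinor]
  ring

theorem inner_crossVec_colVec (A : Matrix (Fin 4) (Fin 3) ℝ) :
    inner ℝ (crossVec A) (colVec A 2) = 0 := by
  rw [inner_crossVec]
  simp [rowMinor, colVec, Matrix.col]
  ring

/-- Cauchy–Binet: both sides are the sum of products of corresponding maximal minors. -/
theorem inner_crossVec_crossVec (A A' : Matrix (Fin 4) (Fin 3) ℝ) :
    inner ℝ (crossVec A) (crossVec A') = (Aᵀ * A').det := by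
  rw [inner_crossVec, Matrix.det_fin_three]
  simp only [crossVec, rowMinor, Matrix.mul_apply, Fin.sum_univ_four, Matrix.transpose_apply,
    Matrix.cons_val]
  ring

/-- Pythagoras: the projection of x to the line of v has length |⟨v, x⟩| / ‖v‖. -/
theorem normProjPerp_eq {v : EuclideanSpace ℝ (Fin 4)} (hv : v ≠ 0)
    (x : EuclideanSpace ℝ (Fin 4)) :
    normProjPerp v x = √(‖x‖ ^ 2 * ‖v‖ ^ 2 - inner ℝ v x ^ 2) / ‖v‖ := by
  have hv' : 0 < ‖v‖ := norm_pos_iff.2 hv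
  have h := Submodule.norm_sq_eq_add_norm_sq_starProjection x (Submodule.span ℝ {v})
  rw [Submodule.starProjection_singleton, norm_smul] at h
  rw [eq_div_iff hv'.ne',
    ← Real.sqrt_sq (mul_nonneg (a := normProjPerp v x) (norm_nonneg _) hv'.le)]
  congr 1
  rw [normProjPerp, mul_pow, eq_sub_of_add_eq' h.symm, Real.norm_eq_abs, mul_pow, sq_abs]
  simp only [RCLike.ofReal_real_eq_id, id]
  field_simp

theorem linkIntegrand_eq (A A' : Matrix (Fin 4) (Fin 3) ℝ) (v : EuclideanSpace ℝ (Fin 4)) :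
    linkIntegrand A A' v = inner ℝ (crossVec A) v * inner ℝ (crossVec A') v * ‖v‖ ^ 4 /
      (√(‖colVec A 2‖ ^ 2 * ‖v‖ ^ 2 - inner ℝ v (colVec A 2) ^ 2) ^ 3 *
        √(‖colVec A' 2‖ ^ 2 * ‖v‖ ^ 2 - inner ℝ v (colVec A' 2) ^ 2) ^ 3) *
      Real.exp (-‖v‖ ^ 2 / 2) := by
  rcases eq_or_ne v 0 with rfl | hv
  · simp [linkIntegrand, det_appendCol]
  have hv' : ‖v‖ ≠ 0 := norm_ne_zero_iff.2 hv
  rw [linkIntegrand, det_appendCol, det_appendCol, normProjPerp_eq hv, normProjPerp_eq hv,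
    inner_smul_right, inner_smul_right]
  congr 1
  field_simp

open MeasureTheory

/-! ### Fibrewise dilations -/

section FibreScaling

variable {X Y : Type*} [NormedAddCommGroup X] [NormedSpace ℝ X] [MeasureSpace X] [BorelSpace X]
  [FiniteDimensional ℝ X] [(volume : Measure X).IsAddHaarMeasure]
  [MeasureSpace Y] [SFinite (volume : Measure Y)]

/-- Rescaling the first variable by a factor that depends on the second one. -/
theorem integrable_and_integral_of_fibre_smul {f : X × Y → ℝ} (hf : Measurable f) {r : Y → ℝ}
    (hr : ∀ᵐ y, 0 < r y)
    (h : Integrable fun z : X × Y => r z.2 ^ Module.finrank ℝ X * f (r z.2 • z.1, z.2)) :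
    Integrable f ∧
      ∫ z, f z = ∫ z : X × Y, r z.2 ^ Module.finrank ℝ X * f (r z.2 • z.1, z.2) := by
  have key : ∀ (g : X → ℝ) {c : ℝ}, 0 < c →
      ∫ x, c ^ Module.finrank ℝ X * g (c • x) = ∫ x, g x := by
    intro g c hc
    rw [integral_const_mul, Measure.integral_comp_smul, abs_of_pos (by positivity), smul_eq_mul,
      ← mul_assoc, mul_inv_cancel₀ (by positivity), one_mul]
  have hint := h
  rw [Measure.volume_eq_prod, integrable_prod_iff' h.aestronglyMeasurable] at h
  have hf' : Integrable f := by
    -- Fubini's criterion holds fibrewise: a dilation preserves integrability, and `key` for ‖f‖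
    -- matches the L¹ norms of the fibres.
    rw [Measure.volume_eq_prod, integrable_prod_iff' hf.aestronglyMeasurable]
    constructor
    · filter_upwards [h.1, hr] with y hy hry
      rw [integrable_const_mul_iff (IsUnit.mk0 _ (by positivity))] at hy
      exact (integrable_comp_smul_iff volume (fun x => f (x, y)) hry.ne').1 hy
    · refine h.2.congr ?_
      filter_upwards [hr] with y hry
      rw [← key (fun x => ‖f (x, y)‖) hry]
      simp only [norm_mul, norm_pow, Real.norm_of_nonneg hry.le]
  refine ⟨hf', ?_⟩
  rw [Measure.volume_eq_prod, integral_prod_symm _ hf', integral_prod_symm _ hint]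
  refine integral_congr_ae ?_
  filter_upwards [hr] with y hry
  exact (key (fun x => f (x, y)) hry).symm

/-- Rescaling the second variable by a factor that depends on the first one. -/
theorem integrable_and_integral_of_fibre_smul' {f : Y × X → ℝ} (hf : Measurable f) {r : Y → ℝ}
    (hr : ∀ᵐ y, 0 < r y)
    (h : Integrable fun z : Y × X => r z.1 ^ Module.finrank ℝ X * f (z.1, r z.1 • z.2)) :
    Integrable f ∧
      ∫ z, f z = ∫ z : Y × X, r z.1 ^ Module.finrank ℝ X * f (z.1, r z.1 • z.2) := by
  obtain ⟨h1, h2⟩ := integrable_and_integral_of_fibre_smul (f := f ∘ Prod.swap)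
    (hf.comp measurable_swap) hr h.swap
  refine ⟨h1.swap, ?_⟩
  have e1 := integral_prod_swap (μ := (volume : Measure Y)) (ν := (volume : Measure X)) f
  have e2 := integral_prod_swap (μ := (volume : Measure Y)) (ν := (volume : Measure X))
    fun z : Y × X => r z.1 ^ Module.finrank ℝ X * f (z.1, r z.1 • z.2)
  exact e1.symm.trans (h2.trans e2)

end FibreScaling

/-! ### One-variable integrals -/

section OneVariable

/-- The weight `(1 + a²)^(-3/2)`. -/
noncomputable def cubeWeight (a : ℝ) : ℝ := (√(1 + a ^ 2) ^ 3)⁻¹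

theorem cubeWeight_neg (a : ℝ) : cubeWeight (-a) = cubeWeight a := by simp [cubeWeight]

theorem cubeWeight_nonneg (a : ℝ) : 0 ≤ cubeWeight a := by unfold cubeWeight; positivity

@[fun_prop]
theorem continuous_cubeWeight : Continuous cubeWeight := by
  unfold cubeWeight
  refine Continuous.inv₀ (by fun_prop) fun a => ?_
  positivity

theorem integrable_cubeWeight_mul {f : ℝ → ℝ} (hf : Continuous f)
    (h : ∀ a, |f a| ≤ √(1 + a ^ 2)) : Integrable fun a => f a * cubeWeight a := by
  refine integrable_inv_one_add_sq.mono' (by fun_prop) (.of_forall fun a => ?_)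
  have hp : 0 < √(1 + a ^ 2) := by positivity
  have hs : √(1 + a ^ 2) ^ 2 = 1 + a ^ 2 := Real.sq_sqrt (by positivity)
  rw [norm_mul, Real.norm_eq_abs, Real.norm_of_nonneg (cubeWeight_nonneg a), cubeWeight, ← hs,
    Real.sqrt_sq hp.le, ← div_eq_mul_inv, div_le_iff₀ (by positivity)]
  calc |f a| ≤ √(1 + a ^ 2) := h a
    _ = _ := by field_simp

theorem integrable_cubeWeight : Integrable cubeWeight := by
  simpa using integrable_cubeWeight_mul (f := fun _ => 1) continuous_const fun a => by
    rw [abs_one, Real.one_le_sqrt]; nlinarith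

theorem integrable_id_mul_cubeWeight : Integrable fun a => a * cubeWeight a :=
  integrable_cubeWeight_mul continuous_id fun a => Real.abs_le_sqrt (by simp)

theorem integral_eq_zero_of_neg {f : ℝ → ℝ} (h : ∀ x, f (-x) = -f x) : ∫ x, f x = 0 := by
  have := integral_neg_eq_self f volume
  simp only [h, integral_neg] at this
  linarith

theorem integral_id_mul_cubeWeight : ∫ a, a * cubeWeight a = 0 :=
  integral_eq_zero_of_neg fun a => by simp [cubeWeight_neg]

-- The antiderivative a / √(1 + a²) increases from −1 to 1.
open Filter Topology in
theorem integral_cubeWeight : ∫ a, cubeWeight a = 2 := by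
  have hd : ∀ a : ℝ, HasDerivAt (fun a => a / √(1 + a ^ 2)) (cubeWeight a) a := by
    intro a
    have hp : 0 < √(1 + a ^ 2) := by positivity
    have hs : √(1 + a ^ 2) ^ 2 = 1 + a ^ 2 := Real.sq_sqrt (by positivity)
    have h1 : HasDerivAt (fun a : ℝ => 1 + a ^ 2) (2 * a) a := by
      simpa using (hasDerivAt_pow 2 a).const_add 1
    have h2 := (hasDerivAt_id a).div (h1.sqrt (by positivity)) hp.ne'
    convert! h2 using 1
    simp only [cubeWeight, id]
    field_simp
    linarith
  have ht : Tendsto (fun a : ℝ => a / √(1 + a ^ 2)) atTop (𝓝 1) := by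
    have h1 : Tendsto (fun a : ℝ => √((a⁻¹) ^ 2 + 1)) atTop (𝓝 1) := by
      have : Tendsto (fun a : ℝ => √((a⁻¹) ^ 2 + 1)) atTop (𝓝 (√(0 ^ 2 + 1))) :=
        ((tendsto_inv_atTop_zero.pow 2).add_const 1).sqrt
      simpa using this
    have h2 := h1.inv₀ one_ne_zero
    rw [inv_one] at h2
    refine h2.congr' ?_
    filter_upwards [eventually_gt_atTop 0] with a ha
    rw [show (1 + a ^ 2 : ℝ) = a ^ 2 * ((a⁻¹) ^ 2 + 1) by field_simp, Real.sqrt_mul (by positivity),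
      Real.sqrt_sq ha.le]
    field_simp
  have hb : Tendsto (fun a : ℝ => a / √(1 + a ^ 2)) atBot (𝓝 (-1)) := by
    have := (ht.comp tendsto_neg_atBot_atTop).neg
    refine this.congr fun a => ?_
    simp [neg_div]
  rw [integral_of_hasDerivAt_of_tendsto hd integrable_cubeWeight hb ht]
  norm_num

/-- The unnormalized Gaussian. -/
noncomputable def gauss (s : ℝ) : ℝ := Real.exp (-s ^ 2 / 2)

@[fun_prop]
theorem continuous_gauss : Continuous gauss := by unfold gauss; fun_prop

theorem gauss_eq : gauss = fun s => Real.exp (-(1 / 2) * s ^ 2) := by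
  ext s; unfold gauss; congr 1; ring

theorem integrable_gauss : Integrable gauss := by
  rw [gauss_eq]; exact integrable_exp_neg_mul_sq (by norm_num)

theorem integrable_id_mul_gauss : Integrable fun s => s * gauss s := by
  rw [gauss_eq]; exact integrable_mul_exp_neg_mul_sq (by norm_num)

theorem integrable_sq_mul_gauss : Integrable fun s => s ^ 2 * gauss s := by
  rw [gauss_eq]
  simpa using integrable_rpow_mul_exp_neg_mul_sq (b := 1 / 2) (by norm_num) (s := 2) (by norm_num)

theorem integral_gauss : ∫ s, gauss s = √(2 * Real.pi) := by
  rw [gauss_eq, integral_gaussian]; congr 1; ring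

theorem integral_id_mul_gauss : ∫ s, s * gauss s = 0 :=
  integral_eq_zero_of_neg fun s => by simp [gauss]

theorem integral_sq_mul_gauss : ∫ s, s ^ 2 * gauss s = √(2 * Real.pi) := by
  have hd : ∀ s, HasDerivAt gauss (-(s * gauss s)) s := by
    intro s
    have h1 : HasDerivAt (fun s : ℝ => -s ^ 2 / 2) (-s) s := by
      convert! ((hasDerivAt_pow 2 s).neg.div_const 2) using 1; push_cast; ring
    convert! h1.exp using 1
    simp only [gauss]; ring
  have := integral_mul_deriv_eq_deriv_mul_of_integrable (u := fun s : ℝ => s) (v := gauss)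
    (u' := fun _ => 1) (v' := fun s => -(s * gauss s)) (fun s _ => hasDerivAt_id' s) (fun s _ => hd s)
    (by simpa [sq, mul_assoc, Pi.mul_def] using integrable_sq_mul_gauss.neg)
    (by simpa [Pi.mul_def] using integrable_gauss) integrable_id_mul_gauss
  rw [← integral_gauss]
  simp only [mul_neg, integral_neg, one_mul, neg_inj] at this
  rw [← this]
  simp only [sq, mul_assoc]

end OneVariable

/-! ### The separated integral -/

section Plane

/-- The squared length of a point of the plane. -/
def sqLen (y : ℝ × ℝ) : ℝ := y.1 ^ 2 + y.2 ^ 2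

theorem sqLen_nonneg (y : ℝ × ℝ) : 0 ≤ sqLen y := by unfold sqLen; positivity

@[fun_prop]
theorem continuous_sqLen : Continuous sqLen := by unfold sqLen; fun_prop

/-- The product weight `((1 + a²)(1 + b²))^(-3/2)`. -/
noncomputable def planeWeight (p : ℝ × ℝ) : ℝ := cubeWeight p.1 * cubeWeight p.2

theorem exp_sqLen (y : ℝ × ℝ) : Real.exp (-sqLen y / 2) = gauss y.1 * gauss y.2 := by
  rw [gauss, gauss, ← Real.exp_add, sqLen]; congr 1; ring

theorem integrable_linear_mul_linear_mul_gauss (e f e' f' : ℝ) :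
    Integrable fun y : ℝ × ℝ =>
      (e * y.1 + f * y.2) * (e' * y.1 + f' * y.2) * Real.exp (-sqLen y / 2) := by
  have h1 := (integrable_sq_mul_gauss.mul_prod integrable_gauss).const_mul (e * e')
  have h2 := (integrable_id_mul_gauss.mul_prod integrable_id_mul_gauss).const_mul (e * f' + f * e')
  have h3 := (integrable_gauss.mul_prod integrable_sq_mul_gauss).const_mul (f * f')
  refine ((h1.add h2).add h3).congr (.of_forall fun y => ?_)
  simp only [Pi.add_apply, exp_sqLen]
  ring

theorem integral_linear_mul_linear_mul_gauss (e f e' f' : ℝ) :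
    ∫ y : ℝ × ℝ, (e * y.1 + f * y.2) * (e' * y.1 + f' * y.2) * Real.exp (-sqLen y / 2) =
      2 * Real.pi * (e * e' + f * f') := by
  have h1 := (integrable_sq_mul_gauss.mul_prod integrable_gauss).const_mul (e * e')
  have h2 := (integrable_id_mul_gauss.mul_prod integrable_id_mul_gauss).const_mul (e * f' + f * e')
  have h3 := (integrable_gauss.mul_prod integrable_sq_mul_gauss).const_mul (f * f')
  have : (fun y : ℝ × ℝ =>
      (e * y.1 + f * y.2) * (e' * y.1 + f' * y.2) * Real.exp (-sqLen y / 2)) =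
      (fun y => e * e' * (y.1 ^ 2 * gauss y.1 * gauss y.2)) +
      (fun y => (e * f' + f * e') * (y.1 * gauss y.1 * (y.2 * gauss y.2))) +
      fun y => f * f' * (gauss y.1 * (y.2 ^ 2 * gauss y.2)) := by
    ext y; simp only [Pi.add_apply, exp_sqLen]; ring
  rw [this, Measure.volume_eq_prod, integral_add' (h1.add h2) h3, integral_add' h1 h2,
    integral_const_mul, integral_const_mul, integral_const_mul,
    integral_prod_mul (fun s => s ^ 2 * gauss s) gauss,
    integral_prod_mul (fun s => s * gauss s) (fun s => s * gauss s),
    integral_prod_mul gauss (fun s => s ^ 2 * gauss s), integral_gauss, integral_sq_mul_gauss,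
    integral_id_mul_gauss, Real.mul_self_sqrt (by positivity)]
  ring

theorem integrable_sqLen_mul_gauss :
    Integrable fun y : ℝ × ℝ => sqLen y * Real.exp (-sqLen y / 2) := by
  refine ((integrable_linear_mul_linear_mul_gauss 1 0 1 0).add
    (integrable_linear_mul_linear_mul_gauss 0 1 0 1)).congr (.of_forall fun y => ?_)
  simp only [Pi.add_apply, sqLen]
  ring

theorem integrable_sqrt_mul_linear_mul_gauss (e f : ℝ) :
    Integrable fun y : ℝ × ℝ =>
      √(sqLen y) * (e * y.1 + f * y.2) * Real.exp (-sqLen y / 2) := by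
  refine (integrable_sqLen_mul_gauss.const_mul (|e| + |f|)).mono'
    (Continuous.aestronglyMeasurable (by fun_prop)) (.of_forall fun y => ?_)
  have hs : √(sqLen y) * √(sqLen y) = sqLen y := Real.mul_self_sqrt (sqLen_nonneg y)
  have h1 : |y.1| ≤ √(sqLen y) := Real.abs_le_sqrt (by unfold sqLen; nlinarith)
  have h2 : |y.2| ≤ √(sqLen y) := Real.abs_le_sqrt (by unfold sqLen; nlinarith)
  have h3 : |e * y.1 + f * y.2| ≤ (|e| + |f|) * √(sqLen y) := by
    refine (abs_add_le _ _).trans ?_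
    rw [abs_mul, abs_mul, add_mul]
    gcongr
  rw [norm_mul, norm_mul, Real.norm_of_nonneg (Real.sqrt_nonneg _), Real.norm_eq_abs,
    Real.norm_of_nonneg (Real.exp_pos _).le]
  calc √(sqLen y) * |e * y.1 + f * y.2| * Real.exp (-sqLen y / 2)
      ≤ √(sqLen y) * ((|e| + |f|) * √(sqLen y)) * Real.exp (-sqLen y / 2) := by gcongr
    _ = _ := by rw [show √(sqLen y) * ((|e| + |f|) * √(sqLen y)) =
                  (|e| + |f|) * (√(sqLen y) * √(sqLen y)) by ring, hs, mul_assoc]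

/-- The integrand in the coordinates in which the weight and the Gaussian separate. -/
noncomputable def separatedIntegrand (N N' e f e' f' : ℝ) (z : (ℝ × ℝ) × ℝ × ℝ) : ℝ :=
  planeWeight z.1 * ((√(sqLen z.2) * z.1.2 * N + (e * z.2.1 + f * z.2.2)) *
    (√(sqLen z.2) * z.1.1 * N' + (e' * z.2.1 + f' * z.2.2)) * Real.exp (-sqLen z.2 / 2))

/-- After expansion, each term with N or N' contains an odd factor ∫ a (1 + a²)^(-3/2) = 0. The
remaining term is 2 · 2 from the weight times the Gaussian covariance 2π(ee' + ff'). -/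
theorem separatedIntegrand_integrable_and_integral (N N' e f e' f' : ℝ) :
    Integrable (separatedIntegrand N N' e f e' f') ∧
      ∫ z, separatedIntegrand N N' e f e' f' z = 8 * Real.pi * (e * e' + f * f') := by
  let g1 : ℝ × ℝ → ℝ := fun p => p.1 * cubeWeight p.1 * (p.2 * cubeWeight p.2)
  let g2 : ℝ × ℝ → ℝ := fun p => cubeWeight p.1 * (p.2 * cubeWeight p.2)
  let g3 : ℝ × ℝ → ℝ := fun p => p.1 * cubeWeight p.1 * cubeWeight p.2
  have i1 : Integrable g1 := integrable_id_mul_cubeWeight.mul_prod integrable_id_mul_cubeWeight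
  have i2 : Integrable g2 := integrable_cubeWeight.mul_prod integrable_id_mul_cubeWeight
  have i3 : Integrable g3 := integrable_id_mul_cubeWeight.mul_prod integrable_cubeWeight
  have i4 : Integrable planeWeight := integrable_cubeWeight.mul_prod integrable_cubeWeight
  have v1 : ∫ p, g1 p = 0 := by
    refine (integral_prod_mul (μ := volume) (ν := volume) (fun a => a * cubeWeight a)
      (fun a => a * cubeWeight a)).trans ?_
    rw [integral_id_mul_cubeWeight, mul_zero]
  have v2 : ∫ p, g2 p = 0 := by
    refine (integral_prod_mul (μ := volume) (ν := volume) cubeWeight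
      (fun a => a * cubeWeight a)).trans ?_
    rw [integral_id_mul_cubeWeight, mul_zero]
  have v3 : ∫ p, g3 p = 0 := by
    refine (integral_prod_mul (μ := volume) (ν := volume) (fun a => a * cubeWeight a)
      cubeWeight).trans ?_
    rw [integral_id_mul_cubeWeight, zero_mul]
  have v4 : ∫ p, planeWeight p = 4 := by
    refine (integral_prod_mul (μ := volume) (ν := volume) cubeWeight cubeWeight).trans ?_
    rw [integral_cubeWeight]; norm_num
  have j1 := (i1.mul_prod integrable_sqLen_mul_gauss).const_mul (N * N')
  have j2 := (i2.mul_prod (integrable_sqrt_mul_linear_mul_gauss e' f')).const_mul N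
  have j3 := (i3.mul_prod (integrable_sqrt_mul_linear_mul_gauss e f)).const_mul N'
  have j4 := i4.mul_prod (integrable_linear_mul_linear_mul_gauss e f e' f')
  have heq : separatedIntegrand N N' e f e' f' =
      (fun z => N * N' * (g1 z.1 * (sqLen z.2 * Real.exp (-sqLen z.2 / 2)))) +
      (fun z => N * (g2 z.1 * (√(sqLen z.2) * (e' * z.2.1 + f' * z.2.2) *
        Real.exp (-sqLen z.2 / 2)))) +
      (fun z => N' * (g3 z.1 * (√(sqLen z.2) * (e * z.2.1 + f * z.2.2) *
        Real.exp (-sqLen z.2 / 2)))) +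
      fun z => planeWeight z.1 * ((e * z.2.1 + f * z.2.2) * (e' * z.2.1 + f' * z.2.2) *
        Real.exp (-sqLen z.2 / 2)) := by
    ext z
    have hs : sqLen z.2 = √(sqLen z.2) * √(sqLen z.2) :=
      (Real.mul_self_sqrt (sqLen_nonneg z.2)).symm
    simp only [Pi.add_apply, separatedIntegrand, g1, g2, g3, planeWeight]
    generalize Real.exp (-sqLen z.2 / 2) = E
    generalize √(sqLen z.2) = r at *
    rw [hs]
    ring
  rw [heq]
  refine ⟨((j1.add j2).add j3).add j4, ?_⟩
  rw [Measure.volume_eq_prod, integral_add' ((j1.add j2).add j3) j4, integral_add' (j1.add j2) j3,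
    integral_add' j1 j2, integral_const_mul, integral_const_mul, integral_const_mul,
    integral_prod_mul g1 (fun y => sqLen y * Real.exp (-sqLen y / 2)), integral_prod_mul g2
      (fun y => √(sqLen y) * (e' * y.1 + f' * y.2) * Real.exp (-sqLen y / 2)),
    integral_prod_mul g3 (fun y => √(sqLen y) * (e * y.1 + f * y.2) * Real.exp (-sqLen y / 2)),
    integral_prod_mul planeWeight (fun y : ℝ × ℝ => (e * y.1 + f * y.2) * (e' * y.1 + f' * y.2) *
        Real.exp (-sqLen y / 2)), integral_linear_mul_linear_mul_gauss, v1, v2, v3, v4]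
  ring

end Plane

/-! ### Changes of variables -/

section Coordinates

theorem ae_sqrt_sqLen_pos : ∀ᵐ y : ℝ × ℝ, 0 < √(sqLen y) := by
  have h : ∀ᵐ y : ℝ × ℝ, y ≠ 0 := by simp [ae_iff]
  filter_upwards [h] with y hy
  rw [Real.sqrt_pos]
  refine lt_of_le_of_ne (sqLen_nonneg y) fun h0 => hy ?_
  have h1 : y.1 = 0 := by unfold sqLen at h0; nlinarith
  have h2 : y.2 = 0 := by unfold sqLen at h0; nlinarith
  exact Prod.ext h1 h2

/-- The integrand in linear coordinates, the squared length being
`(u α + w β)² + β² + s² + t²`. -/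
noncomputable def planarIntegrand (N N' e f e' f' g d u w : ℝ) (z : (ℝ × ℝ) × ℝ × ℝ) : ℝ :=
  (z.1.2 * N + (e * z.2.1 + f * z.2.2)) * (z.1.1 * N' + (e' * z.2.1 + f' * z.2.2)) *
    ((u * z.1.1 + w * z.1.2) ^ 2 + z.1.2 ^ 2 + sqLen z.2) ^ 2 /
    (√(g ^ 2 * (z.1.2 ^ 2 + sqLen z.2)) ^ 3 * √(d ^ 2 * (z.1.1 ^ 2 + sqLen z.2)) ^ 3) *
    Real.exp (-((u * z.1.1 + w * z.1.2) ^ 2 + z.1.2 ^ 2 + sqLen z.2) / 2)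

/-- Power count in κ: −2 from the Jacobian of y, −2 from that of p, −2 from the two linear forms and
+6 from the denominator. The squared length becomes |y|², free of κ. -/
theorem planarIntegrand_scaled (N N' e f e' f' u w : ℝ) {g d : ℝ} (hg : 0 < g) (hd : 0 < d)
    {κ : ℝ} (hκ : 0 < κ) (p y : ℝ × ℝ) (hκ2 : κ ^ 2 = (u * p.1 + w * p.2) ^ 2 + p.2 ^ 2 + 1) :
    κ⁻¹ ^ 2 * (√(sqLen (κ⁻¹ • y)) ^ 2 *
      planarIntegrand N N' e f e' f' g d u w (√(sqLen (κ⁻¹ • y)) • p, κ⁻¹ • y)) =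
      (g ^ 3 * d ^ 3)⁻¹ * separatedIntegrand N N' e f e' f' (p, y) := by
  have hlen : sqLen (κ⁻¹ • y) = (√(sqLen y) * κ⁻¹) ^ 2 := by
    rw [mul_pow, Real.sq_sqrt (sqLen_nonneg y)]
    simp only [sqLen, Prod.smul_fst, Prod.smul_snd, smul_eq_mul]
    ring
  have hR2 : sqLen y = √(sqLen y) ^ 2 := (Real.sq_sqrt (sqLen_nonneg y)).symm
  rcases (Real.sqrt_nonneg (sqLen y)).eq_or_lt with h0 | hR
  -- At y = 0 both sides vanish, so the identity needs no exceptional set.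
  · have hz : sqLen y = 0 := by rw [hR2, ← h0]; norm_num
    have h1 : y.1 = 0 := by unfold sqLen at hz; nlinarith
    have h2 : y.2 = 0 := by unfold sqLen at hz; nlinarith
    rw [hlen, ← h0]
    simp [separatedIntegrand, ← h0, h1, h2]
  · rw [hlen, Real.sqrt_sq (by positivity)]
    have hA : ∀ c a : ℝ, 0 < c → √(c ^ 2 * ((√(sqLen y) * κ⁻¹ * a) ^ 2 + (√(sqLen y) * κ⁻¹) ^ 2)) =
        c * (√(sqLen y) * κ⁻¹) * √(1 + a ^ 2) := by
      intro c a hc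
      rw [show c ^ 2 * ((√(sqLen y) * κ⁻¹ * a) ^ 2 + (√(sqLen y) * κ⁻¹) ^ 2) =
        (c * (√(sqLen y) * κ⁻¹)) ^ 2 * (1 + a ^ 2) by ring, Real.sqrt_mul (by positivity),
        Real.sqrt_sq (by positivity)]
    have hL : (u * (√(sqLen y) * κ⁻¹ * p.1) + w * (√(sqLen y) * κ⁻¹ * p.2)) ^ 2 +
        (√(sqLen y) * κ⁻¹ * p.2) ^ 2 + (√(sqLen y) * κ⁻¹) ^ 2 = sqLen y := by
      rw [show (u * (√(sqLen y) * κ⁻¹ * p.1) + w * (√(sqLen y) * κ⁻¹ * p.2)) ^ 2 +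
        (√(sqLen y) * κ⁻¹ * p.2) ^ 2 + (√(sqLen y) * κ⁻¹) ^ 2 =
        (√(sqLen y) * κ⁻¹) ^ 2 * ((u * p.1 + w * p.2) ^ 2 + p.2 ^ 2 + 1) by ring, ← hκ2]
      conv_rhs => rw [hR2]
      field_simp
    simp only [planarIntegrand, separatedIntegrand, planeWeight, cubeWeight, Prod.smul_fst,
      Prod.smul_snd, smul_eq_mul, hlen, hA _ _ hg, hA _ _ hd, hL]
    have hp1 : 0 < √(1 + p.1 ^ 2) := by positivity
    have hp2 : 0 < √(1 + p.2 ^ 2) := by positivity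
    generalize √(1 + p.1 ^ 2) = P1 at *
    generalize √(1 + p.2 ^ 2) = P2 at *
    generalize Real.exp (-sqLen y / 2) = E
    generalize √(sqLen y) = R at *
    rw [hR2]
    field_simp

theorem planarIntegrand_integrable_and_integral (N N' e f e' f' u w : ℝ) {g d : ℝ} (hg : 0 < g)
    (hd : 0 < d) :
    Integrable (planarIntegrand N N' e f e' f' g d u w) ∧
      ∫ z, planarIntegrand N N' e f e' f' g d u w z =
        8 * Real.pi * (e * e' + f * f') / (g ^ 3 * d ^ 3) := by
  have hfr : Module.finrank ℝ (ℝ × ℝ) = 2 := by simp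
  have hm : Measurable (planarIntegrand N N' e f e' f' g d u w) := by
    unfold planarIntegrand sqLen; fun_prop
  obtain ⟨hi, hv⟩ := separatedIntegrand_integrable_and_integral N N' e f e' f'
  let κ : ℝ × ℝ → ℝ := fun p => √((u * p.1 + w * p.2) ^ 2 + p.2 ^ 2 + 1)
  have hκ : ∀ p, 0 < κ p := fun p => by positivity
  have heq : (fun z : (ℝ × ℝ) × ℝ × ℝ => (κ z.1)⁻¹ ^ Module.finrank ℝ (ℝ × ℝ) *
      (√(sqLen ((κ z.1)⁻¹ • z.2)) ^ 2 * planarIntegrand N N' e f e' f' g d u w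
        (√(sqLen ((κ z.1)⁻¹ • z.2)) • z.1, (κ z.1)⁻¹ • z.2))) =
      fun z => (g ^ 3 * d ^ 3)⁻¹ * separatedIntegrand N N' e f e' f' z := by
    ext z
    rw [hfr]
    exact planarIntegrand_scaled N N' e f e' f' u w hg hd (hκ z.1) z.1 z.2
      (Real.sq_sqrt (by positivity))
  -- The substitutions are undone in reverse: first y ↦ y/κ(p), on the integrand already scaled in
  -- p; its integrability then feeds `h1`.
  have h2 := integrable_and_integral_of_fibre_smul' (X := ℝ × ℝ) (Y := ℝ × ℝ)
    (f := fun z => √(sqLen z.2) ^ 2 *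
      planarIntegrand N N' e f e' f' g d u w (√(sqLen z.2) • z.1, z.2))
    (by unfold planarIntegrand sqLen; simp only [Prod.smul_fst, Prod.smul_snd]; fun_prop)
    (r := fun p => (κ p)⁻¹) (.of_forall fun p => inv_pos.2 (hκ p))
    (by rw [heq]; exact hi.const_mul _)
  have h1 := integrable_and_integral_of_fibre_smul (X := ℝ × ℝ) (Y := ℝ × ℝ) hm
    ae_sqrt_sqLen_pos (by rw [hfr]; exact h2.1)
  refine ⟨h1.1, ?_⟩
  rw [h1.2, hfr, h2.2, heq, integral_const_mul, hv]
  field_simp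

theorem measurePreserving_fourTuple :
    MeasurePreserving (fun z : (ℝ × ℝ) × ℝ × ℝ => ![z.1.1, z.1.2, z.2.1, z.2.2]) := by
  have hm : Measurable (fun z : (ℝ × ℝ) × ℝ × ℝ => ![z.1.1, z.1.2, z.2.1, z.2.2]) := by
    refine measurable_pi_lambda _ fun i => ?_
    fin_cases i <;> simp <;> fun_prop
  refine ⟨hm, ?_⟩
  rw [volume_pi]
  refine (Measure.pi_eq fun s hs => ?_).symm
  rw [Measure.map_apply hm (MeasurableSet.univ_pi hs)]
  have : (fun z : (ℝ × ℝ) × ℝ × ℝ => ![z.1.1, z.1.2, z.2.1, z.2.2]) ⁻¹' Set.univ.pi s =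
      (s 0 ×ˢ s 1) ×ˢ (s 2 ×ˢ s 3) := by
    ext z
    simp [Set.mem_pi, Fin.forall_fin_succ, and_assoc]
  rw [this]
  simp only [Measure.volume_eq_prod, Measure.prod_prod, Fin.prod_univ_four, mul_assoc]

/-- Linear coordinates on Euclidean space given by a matrix in an orthonormal basis. -/
noncomputable def basisCoord (b : OrthonormalBasis (Fin 4) ℝ (EuclideanSpace ℝ (Fin 4)))
    (M : Matrix (Fin 4) (Fin 4) ℝ) (z : (ℝ × ℝ) × ℝ × ℝ) : EuclideanSpace ℝ (Fin 4) :=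
  b.repr.symm (WithLp.toLp 2 (M.toLin' ![z.1.1, z.1.2, z.2.1, z.2.2]))

theorem measurable_basisCoord (b : OrthonormalBasis (Fin 4) ℝ (EuclideanSpace ℝ (Fin 4)))
    (M : Matrix (Fin 4) (Fin 4) ℝ) : Measurable (basisCoord b M) :=
  b.measurePreserving_repr_symm.measurable.comp <|
    (PiLp.volume_preserving_toLp (Fin 4)).measurable.comp <|
    M.toLin'.continuous_of_finiteDimensional.measurable.comp measurePreserving_fourTuple.measurable

theorem map_basisCoord (b : OrthonormalBasis (Fin 4) ℝ (EuclideanSpace ℝ (Fin 4)))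
    {M : Matrix (Fin 4) (Fin 4) ℝ} (hM : M.det ≠ 0) :
    Measure.map (basisCoord b M) volume = ENNReal.ofReal |M.det⁻¹| • volume := by
  have h1 := measurePreserving_fourTuple
  have h2 : Measurable M.toLin' := M.toLin'.continuous_of_finiteDimensional.measurable
  have h3 := (b.measurePreserving_repr_symm.comp (PiLp.volume_preserving_toLp (Fin 4)))
  have : basisCoord b M = (b.repr.symm ∘ WithLp.toLp 2) ∘ M.toLin' ∘
    fun z : (ℝ × ℝ) × ℝ × ℝ => ![z.1.1, z.1.2, z.2.1, z.2.2] := rfl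
  rw [this, ← Measure.map_map h3.measurable (h2.comp h1.measurable),
    ← Measure.map_map h2 h1.measurable, h1.map_eq, Real.map_matrix_volume_pi_eq_smul_volume_pi hM,
    Measure.map_smul, h3.map_eq]

theorem integrable_and_integral_of_basisCoord
    (b : OrthonormalBasis (Fin 4) ℝ (EuclideanSpace ℝ (Fin 4)))
    {M : Matrix (Fin 4) (Fin 4) ℝ} (hM : M.det ≠ 0) {F : EuclideanSpace ℝ (Fin 4) → ℝ}
    (hF : Measurable F) (h : Integrable fun z => F (basisCoord b M z)) :
    Integrable F ∧ ∫ v, F v = |M.det| * ∫ z, F (basisCoord b M z) := by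
  have hm := measurable_basisCoord b M
  have hpos : 0 < |M.det⁻¹| := abs_pos.2 (inv_ne_zero hM)
  constructor
  · have := (integrable_map_measure hF.aestronglyMeasurable hm.aemeasurable).2 h
    rw [map_basisCoord b hM, integrable_smul_measure (by simpa using hM) ENNReal.ofReal_ne_top]
      at this
    exact this
  · rw [← integral_map hm.aemeasurable hF.aestronglyMeasurable, map_basisCoord b hM,
      integral_smul_measure, ENNReal.toReal_ofReal hpos.le, smul_eq_mul, ← mul_assoc, ← abs_mul,
      mul_inv_cancel₀ hM, abs_one, one_mul]

end Coordinates

/-! ### The integrand in an adapted basis -/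

section Geometry

/-- The integrand written with inner products only. -/
noncomputable def innerIntegrand (n n' c d v : EuclideanSpace ℝ (Fin 4)) : ℝ :=
  inner ℝ n v * inner ℝ n' v * ‖v‖ ^ 4 /
      (√(‖c‖ ^ 2 * ‖v‖ ^ 2 - inner ℝ v c ^ 2) ^ 3 * √(‖d‖ ^ 2 * ‖v‖ ^ 2 - inner ℝ v d ^ 2) ^ 3) *
      Real.exp (-‖v‖ ^ 2 / 2)

theorem measurable_innerIntegrand (n n' c d : EuclideanSpace ℝ (Fin 4)) :
    Measurable (innerIntegrand n n' c d) := by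
  unfold innerIntegrand; fun_prop

/-- The matrix of the coordinates that separate the two Gram determinants. -/
noncomputable def gramMatrix (δ d0 d1 : ℝ) : Matrix (Fin 4) (Fin 4) ℝ :=
  !![δ / d1, d0 / d1, 0, 0; 0, 1, 0, 0; 0, 0, 1, 0; 0, 0, 0, 1]

theorem det_gramMatrix (δ d0 d1 : ℝ) : (gramMatrix δ d0 d1).det = δ / d1 := by
  simp [gramMatrix, Matrix.det_succ_row_zero, Fin.sum_univ_succ, Fin.succAbove]

variable (b : OrthonormalBasis (Fin 4) ℝ (EuclideanSpace ℝ (Fin 4)))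

theorem inner_eq_sum_repr (x y : EuclideanSpace ℝ (Fin 4)) :
    inner ℝ x y = b.repr x 0 * b.repr y 0 + b.repr x 1 * b.repr y 1 + b.repr x 2 * b.repr y 2 +
      b.repr x 3 * b.repr y 3 := by
  rw [← b.repr.inner_map_map x y, PiLp.inner_apply, Fin.sum_univ_four]
  simp only [RCLike.inner_apply, conj_trivial]
  ring

theorem repr_basisCoord_gramMatrix (δ d0 d1 : ℝ) (z : (ℝ × ℝ) × ℝ × ℝ) :
    b.repr (basisCoord b (gramMatrix δ d0 d1) z) =
      !₂[δ / d1 * z.1.1 + d0 / d1 * z.1.2, z.1.2, z.2.1, z.2.2] := by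
  rw [basisCoord, LinearIsometryEquiv.apply_symm_apply]
  ext i
  fin_cases i <;> simp [gramMatrix, Matrix.mulVec, dotProduct, Fin.sum_univ_four]

/-- The coordinate `z.1.1` is the component of v along the unit vector (d₁, −d₀)/‖d‖ of the first
coordinate plane, which is orthogonal to d; `z.1.2` is the component orthogonal to c. This makes
both Gram determinants diagonal. -/
theorem innerIntegrand_basisCoord {n n' c d : EuclideanSpace ℝ (Fin 4)}
    (hc : ∀ i, i ≠ 0 → b.repr c i = 0) (hd2 : b.repr d 2 = 0) (hd3 : b.repr d 3 = 0)
    (hd1 : b.repr d 1 ≠ 0) (hn : b.repr n 0 = 0) (hn' : inner ℝ n' d = 0)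
    (z : (ℝ × ℝ) × ℝ × ℝ) :
    innerIntegrand n n' c d (basisCoord b (gramMatrix ‖d‖ (b.repr d 0) (b.repr d 1)) z) =
      planarIntegrand (b.repr n 1) (‖d‖ / b.repr d 1 * b.repr n' 0) (b.repr n 2) (b.repr n 3)
        (b.repr n' 2) (b.repr n' 3) ‖c‖ ‖d‖ (‖d‖ / b.repr d 1) (b.repr d 0 / b.repr d 1) z := by
  have hc1 := hc 1 (by decide)
  have hc2 := hc 2 (by decide)
  have hc3 := hc 3 (by decide)
  set v := basisCoord b (gramMatrix ‖d‖ (b.repr d 0) (b.repr d 1)) z with hv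
  have hr := repr_basisCoord_gramMatrix b ‖d‖ (b.repr d 0) (b.repr d 1) z
  rw [← hv] at hr
  have nc : ‖c‖ ^ 2 = b.repr c 0 ^ 2 := by
    rw [← real_inner_self_eq_norm_sq, inner_eq_sum_repr b, hc1, hc2, hc3]; ring
  have nd : ‖d‖ ^ 2 = b.repr d 0 ^ 2 + b.repr d 1 ^ 2 := by
    rw [← real_inner_self_eq_norm_sq, inner_eq_sum_repr b, hd2, hd3]; ring
  have nv : ‖v‖ ^ 2 = (‖d‖ / b.repr d 1 * z.1.1 + b.repr d 0 / b.repr d 1 * z.1.2) ^ 2 +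
      z.1.2 ^ 2 + sqLen z.2 := by
    rw [← real_inner_self_eq_norm_sq, inner_eq_sum_repr b, hr]
    simp [sqLen]
    ring
  have iv : inner ℝ n v = z.1.2 * b.repr n 1 + (b.repr n 2 * z.2.1 + b.repr n 3 * z.2.2) := by
    rw [inner_eq_sum_repr b, hr, hn]
    simp
    ring
  have iv' : inner ℝ n' v = z.1.1 * (‖d‖ / b.repr d 1 * b.repr n' 0) +
      (b.repr n' 2 * z.2.1 + b.repr n' 3 * z.2.2) := by
    rw [inner_eq_sum_repr b, hd2, hd3] at hn'
    rw [inner_eq_sum_repr b, hr]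
    simp
    field_simp
    -- n' ⊥ d removes `z.1.2` from the second linear form.
    linear_combination z.1.2 * hn'
  have gc : ‖c‖ ^ 2 * ‖v‖ ^ 2 - inner ℝ v c ^ 2 = ‖c‖ ^ 2 * (z.1.2 ^ 2 + sqLen z.2) := by
    rw [inner_eq_sum_repr b v c, nv, hr, hc1, hc2, hc3, nc]
    simp
    ring
  have gd : ‖d‖ ^ 2 * ‖v‖ ^ 2 - inner ℝ v d ^ 2 = ‖d‖ ^ 2 * (z.1.1 ^ 2 + sqLen z.2) := by
    rw [inner_eq_sum_repr b v d, nv, hr, hd2, hd3]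
    simp
    field_simp
    linear_combination ((‖d‖ * z.1.1 + b.repr d 0 * z.1.2) ^ 2 + b.repr d 1 ^ 2 * z.1.2 ^ 2) * nd
  rw [innerIntegrand, planarIntegrand, gc, gd, iv, iv', ← nv]
  ring

/-- The Jacobian ‖d‖ / |d₁| accounts for ‖d‖² in place of ‖d‖³. -/
theorem innerIntegrand_integrable_and_integral {n n' c d : EuclideanSpace ℝ (Fin 4)}
    (hc : ∀ i, i ≠ 0 → b.repr c i = 0) (hd2 : b.repr d 2 = 0) (hd3 : b.repr d 3 = 0)
    (hc0 : b.repr c 0 ≠ 0) (hd1 : b.repr d 1 ≠ 0) (hn : inner ℝ n c = 0) (hn' : inner ℝ n' d = 0) :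
    Integrable (innerIntegrand n n' c d) ∧
      ∫ v, innerIntegrand n n' c d v = 8 * Real.pi *
        (b.repr n 2 * b.repr n' 2 + b.repr n 3 * b.repr n' 3) /
          (|b.repr d 1| * ‖c‖ ^ 3 * ‖d‖ ^ 2) := by
  have hn0 : b.repr n 0 = 0 := by
    rw [inner_eq_sum_repr b, hc 1 (by decide), hc 2 (by decide), hc 3 (by decide)] at hn
    simpa [hc0] using hn
  have hcp : 0 < ‖c‖ := norm_pos_iff.2 fun h => hc0 (by simp [h])
  have hdp : 0 < ‖d‖ := norm_pos_iff.2 fun h => hd1 (by simp [h])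
  obtain ⟨h1, h2⟩ := planarIntegrand_integrable_and_integral (b.repr n 1)
    (‖d‖ / b.repr d 1 * b.repr n' 0) (b.repr n 2) (b.repr n 3) (b.repr n' 2) (b.repr n' 3)
    (‖d‖ / b.repr d 1) (b.repr d 0 / b.repr d 1) hcp hdp
  have heq := funext (innerIntegrand_basisCoord b hc hd2 hd3 hd1 hn0 hn')
  obtain ⟨h3, h4⟩ := integrable_and_integral_of_basisCoord b
    (M := gramMatrix ‖d‖ (b.repr d 0) (b.repr d 1)) (by rw [det_gramMatrix]; positivity)
    (measurable_innerIntegrand n n' c d) (heq ▸ h1)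
  refine ⟨h3, ?_⟩
  rw [h4, heq, h2, det_gramMatrix, abs_div, abs_of_pos hdp]
  have := abs_pos.2 hd1
  field_simp

end Geometry

/-! ### Adapted basis and conclusion -/

theorem exists_orthonormalBasis_adapted (c d : EuclideanSpace ℝ (Fin 4)) :
    ∃ b : OrthonormalBasis (Fin 4) ℝ (EuclideanSpace ℝ (Fin 4)),
      (∀ i, i ≠ 0 → b.repr c i = 0) ∧ b.repr d 2 = 0 ∧ b.repr d 3 = 0 := by
  have hfr : Module.finrank ℝ (EuclideanSpace ℝ (Fin 4)) = Fintype.card (Fin 4) := by simp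
  -- The zeros are padding; the orthonormal system is completed to a basis.
  let b := InnerProductSpace.gramSchmidtOrthonormalBasis hfr ![c, d, 0, 0]
  have key : ∀ i j : Fin 4, i < j → b.repr (![c, d, 0, 0] i) j = 0 := fun i j hij =>
    InnerProductSpace.gramSchmidtOrthonormalBasis_inv_triangular' hfr _ hij
  exact ⟨b, fun i hi => key 0 i (Fin.pos_of_ne_zero hi), key 1 2 (by decide), key 1 3 (by decide)⟩

theorem mainTheorem2 (A A' : Matrix (Fin 4) (Fin 3) ℝ)
    (hindep : LinearIndependent ℝ ![colVec A 2, colVec A' 2]) :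
    MeasureTheory.Integrable (linkIntegrand A A') ∧
    Real.pi / 2 * ILinkSq A A' =
      ((‖colVec A 2‖ ^ 2 * ‖colVec A' 2‖ ^ 2 - (inner ℝ (colVec A 2) (colVec A' 2)) ^ 2) *
            (Aᵀ * A').det +
          inner ℝ (colVec A 2) (colVec A' 2) *
            (prependCol (colVec A 2) A').det * (prependCol (colVec A' 2) A).det) /
        (‖colVec A 2‖ ^ 2 * ‖colVec A' 2‖ ^ 2 *
          (‖colVec A 2‖ ^ 2 * ‖colVec A' 2‖ ^ 2 -
            (inner ℝ (colVec A 2) (colVec A' 2)) ^ 2) ^ (3 / 2 : ℝ)) := by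
  have heq : linkIntegrand A A' =
      innerIntegrand (crossVec A) (crossVec A') (colVec A 2) (colVec A' 2) :=
    funext (linkIntegrand_eq A A')
  have hn := inner_crossVec_colVec A
  have hn' := inner_crossVec_colVec A'
  rw [ILinkSq, heq, ← inner_crossVec_crossVec, det_prependCol, det_prependCol]
  generalize colVec A 2 = c at *
  generalize colVec A' 2 = d at *
  generalize crossVec A = n at *
  generalize crossVec A' = n' at *
  obtain ⟨b, hc, hd2, hd3⟩ := exists_orthonormalBasis_adapted c d
  have hc1 := hc 1 (by decide)
  have hc2 := hc 2 (by decide)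
  have hc3 := hc 3 (by decide)
  rw [LinearIndependent.pair_iff] at hindep
  have hc0 : b.repr c 0 ≠ 0 := by
    intro h
    have : c = 0 := by
      apply b.repr.injective
      ext i
      fin_cases i <;> simp [h, hc1, hc2, hc3]
    exact one_ne_zero (hindep 1 0 (by simp [this])).1
  have hd1 : b.repr d 1 ≠ 0 := by
    intro h
    -- If d₁ = 0, then c and d lie on the first axis and d₀c − c₀d = 0.
    refine hc0 (neg_eq_zero.1 (hindep (b.repr d 0) (-b.repr c 0) ?_).2)
    apply b.repr.injective
    ext i
    fin_cases i <;> simp [h, hc1, hc2, hc3, hd2, hd3, mul_comm]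
  obtain ⟨hi, hv⟩ := innerIntegrand_integrable_and_integral b hc hd2 hd3 hc0 hd1 hn hn'
  refine ⟨hi, ?_⟩
  have nc : ‖c‖ ^ 2 = b.repr c 0 ^ 2 := by
    rw [← real_inner_self_eq_norm_sq, inner_eq_sum_repr b, hc1, hc2, hc3]; ring
  have nd : ‖d‖ ^ 2 = b.repr d 0 ^ 2 + b.repr d 1 ^ 2 := by
    rw [← real_inner_self_eq_norm_sq, inner_eq_sum_repr b, hd2, hd3]; ring
  have icd : inner ℝ c d = b.repr c 0 * b.repr d 0 := by
    rw [inner_eq_sum_repr b, hc1, hc2, hc3]; ring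
  have hcp : 0 < ‖c‖ := norm_pos_iff.2 fun h => hc0 (by simp [h])
  have hdp : 0 < ‖d‖ := norm_pos_iff.2 fun h => hd1 (by simp [h])
  have hD : 0 < |b.repr d 1| := abs_pos.2 hd1
  have gram : ‖c‖ ^ 2 * ‖d‖ ^ 2 - inner ℝ c d ^ 2 = (‖c‖ * |b.repr d 1|) ^ 2 := by
    rw [mul_pow, sq_abs, icd, nd, nc]; ring
  have num : (‖c‖ ^ 2 * ‖d‖ ^ 2 - inner ℝ c d ^ 2) * inner ℝ n n' +
      inner ℝ c d * -inner ℝ n' c * -inner ℝ n d =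
      (‖c‖ * |b.repr d 1|) ^ 2 * (b.repr n 2 * b.repr n' 2 + b.repr n 3 * b.repr n' 3) := by
    rw [gram, mul_pow, sq_abs, nc, icd, inner_eq_sum_repr b n n', inner_eq_sum_repr b n' c,
      inner_eq_sum_repr b n d, hc1, hc2, hc3, hd2, hd3]
    rw [inner_eq_sum_repr b, hc1, hc2, hc3] at hn
    rw [inner_eq_sum_repr b, hd2, hd3] at hn'
    have hn0 : b.repr n 0 = 0 := by simpa [hc0] using hn
    rw [hn0]
    -- What is left is c₀²d₁n₁(d₀n'₀ + d₁n'₁), zero since n' ⊥ d: the second term of the formula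
    -- cancels the n₁n'₁ part of ⟨n, n'⟩.
    linear_combination b.repr c 0 ^ 2 * b.repr d 1 * b.repr n 1 * hn'
  have hpow : ((‖c‖ * |b.repr d 1|) ^ 2) ^ (3 / 2 : ℝ) = (‖c‖ * |b.repr d 1|) ^ 3 := by
    rw [← Real.rpow_natCast, ← Real.rpow_mul (by positivity), ← Real.rpow_natCast]
    norm_num
  rw [num, gram, hpow, hv]
  have := Real.pi_pos
  field_simp
  norm_num
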